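/- Let $(W,S)$ be a Coxeter system with $S$ finite, with Coxeter matrix $(m(s,t))_{s,t\in S}$, and suppose that it is of type $\Lambda$: it is simply laced, i.e. $m(s,t)\le 3$ for all $s,t\in S$, and triangle free, i.e. the Coxeter graph (vertex set $S$, with $s,t$ adjacent if and only if $m(s,t)\ge 3$) contains no three-cycle. For a reduced expression $\boldsymbol{\alpha}$ of an element of $W$, the braid class $[\boldsymbol{\alpha}]$ is the set of all reduced expressions obtained from $\boldsymbol{\alpha}$ by finite sequences of braid moves (replacing a factor $\underbrace{sts\cdots}_{m(s,t)}$ with $3\le m(s,t)<\infty$ by $\underbrace{tst\cdots}_{m(s,t)}$; here $sts\mapsto tst$ with $m(s,t)=3$). The braid graph $\mathcal{B}(\boldsymbol{\alpha})$ has vertex set $[\boldsymbol{\alpha}]$, two vertices being adjacent if and only if they are related by a single braid move. Then for every reduced expression $\boldsymbol{\alpha}$, the braid graph $\mathcal{B}(\boldsymbol{\alpha})$ is median: it is connected and, for all vertices $u,v,w$, $$|I(u,v)\cap I(u,w)\cap I(v,w)|=1,\qquad\text{where } I(x,y)=\{z : d(x,y)=d(x,z)+d(z,y)\}$$ and $d$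 is the graph distance. -/

import Mathlib

/-! ### Median graphs -/

namespace SimpleGraph

variable {V : Type*} (G : SimpleGraph V)

/-- The interval `I(u, v)`: the vertices that lie on some geodesic between `u` and `v`. -/
def geodesicInterval (u v : V) : Set V :=
  {w | G.dist u v = G.dist u w + G.dist w v}

/-- A connected graph is median if `I(u, v) ∩ I(u, w) ∩ I(v, w)` has exactly one element for all
vertices `u, v, w`. -/
def IsMedian : Prop :=
  G.Connected ∧ ∀ u v w : V,
    (G.geodesicInterval u v ∩ G.geodesicInterval u w ∩ G.geodesicInterval v w).ncard = 1

end SimpleGraph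

/-! ### Coxeter systems of type `Λ` -/

namespace CoxeterMatrix

variable {B : Type*} (M : CoxeterMatrix B)

/-- `m(s, t) ≤ 3` for all generators (Mathlib encodes `m(s, t) = ∞` by `M s t = 0`). -/
def IsSimplyLaced : Prop :=
  ∀ s t : B, M s t ≠ 0 ∧ M s t ≤ 3

/-- The Coxeter graph: `s` and `t` are adjacent iff `m(s, t) ≥ 3`, the value `∞`
(encoded by `0`) included. -/
def coxeterGraph : SimpleGraph B where
  Adj s t := M s t = 0 ∨ 3 ≤ M s t
  symm := ⟨fun s t h => by rwa [M.symmetric t s]⟩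
  loopless := ⟨fun s h => by simp at h⟩

/-- The Coxeter graph contains no three-cycle. -/
def IsTriangleFree : Prop :=
  M.coxeterGraph.CliqueFree 3

/-- Type `Λ`: simply laced and triangle free. -/
def IsTypeLambda : Prop :=
  M.IsSimplyLaced ∧ M.IsTriangleFree

/-! ### Braid moves, braid classes, braid graphs -/

/-- `β` is obtained from `α` by a single braid move, that is, by replacing a factor
`⋯sts` (with `m(s, t)` letters, `3 ≤ m(s, t) < ∞`) by `⋯tst` (with `m(s, t)` letters). -/
def BraidMove (α β : List B) : Prop :=
  ∃ (s t : B) (l r : List B), 3 ≤ M s t ∧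
    α = l ++ CoxeterSystem.braidWord M s t ++ r ∧
    β = l ++ CoxeterSystem.braidWord M t s ++ r

theorem BraidMove.symm {M : CoxeterMatrix B} {α β : List B} (h : M.BraidMove α β) :
    M.BraidMove β α := by
  obtain ⟨s, t, l, r, h3, h1, h2⟩ := h
  exact ⟨t, s, l, r, M.symmetric s t ▸ h3, h2, h1⟩

theorem BraidMove.irrefl (α : List B) : ¬ M.BraidMove α α := by
  rintro ⟨s, t, l, r, h3, h1, h2⟩
  have h := h1.symm.trans h2
  simp only [List.append_assoc, List.append_cancel_left_eq] at h
  replace h := List.append_cancel_right h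
  have hst : s ≠ t := by
    rintro rfl
    simp at h3
  rw [CoxeterSystem.braidWord, CoxeterSystem.braidWord, M.symmetric t s] at h
  obtain ⟨k, hk⟩ : ∃ k, M s t = k + 1 := ⟨M s t - 1, by omega⟩
  rw [hk, CoxeterSystem.alternatingWord_succ, CoxeterSystem.alternatingWord_succ] at h
  simp only [List.concat_eq_append] at h
  have := (List.append_inj' h rfl).2
  simp only [List.cons.injEq, and_true] at this
  exact hst this.symm

/-- Braid equivalence: the smallest equivalence relation that contains all braid moves. -/
def BraidEquiv : List B → List B → Prop :=
  Relation.EqvGen M.BraidMove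

/-- The braid class `[α]`. -/
def braidClass (α : List B) : Set (List B) :=
  {β | M.BraidEquiv α β}

/-- The braid graph of `α`: its vertices are the elements of the braid class `[α]`, and two of
them are adjacent iff they are related by a single braid move. -/
def braidGraph (α : List B) : SimpleGraph (M.braidClass α) where
  Adj β γ := M.BraidMove β γ
  symm := ⟨fun _ _ h => h.symm⟩
  loopless := ⟨fun β h => BraidMove.irrefl M β h⟩

theorem BraidEquiv.length_eq {M : CoxeterMatrix B} {α β : List B} (h : M.BraidEquiv α β) :
    α.length = β.length := by
  induction h with
  | rel α β h =>
    obtain ⟨s, t, l, r, -, rfl, rfl⟩ := h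
    simp [M.symmetric t s]
  | refl => rfl
  | symm _ _ _ ih => exact ih.symm
  | trans _ _ _ _ _ ih₁ ih₂ => exact ih₁.trans ih₂

/-- Over a finite generating set, braid graphs are finite. -/
instance [Finite B] (α : List B) : Finite (M.braidClass α) :=
  Set.Finite.subset (List.finite_length_eq B α.length) fun _ h => h.length_eq.symm

end CoxeterMatrix

/-- Braid moves do not change the group element. -/
theorem CoxeterMatrix.BraidEquiv.wordProd_eq {B W : Type*} [Group W] {M : CoxeterMatrix B}
    (cs : CoxeterSystem M W) {α β : List B} (h : M.BraidEquiv α β) :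
    cs.wordProd α = cs.wordProd β := by
  induction h with
  | rel α β h =>
    obtain ⟨s, t, l, r, -, rfl, rfl⟩ := h
    simp only [cs.wordProd_append, cs.wordProd_braidWord_eq s t]
  | refl => rfl
  | symm _ _ _ ih => exact ih.symm
  | trans _ _ _ _ _ ih₁ ih₂ => exact ih₁.trans ih₂

/-- Hence every word in the braid class of a reduced expression is again a reduced expression of
the same group element, and braid equivalence of words restricts to that of reduced expressions. -/
theorem CoxeterMatrix.BraidEquiv.isReduced {B W : Type*} [Group W] {M : CoxeterMatrix B}
    (cs : CoxeterSystem M W) {α β : List B} (h : M.BraidEquiv α β) (hα : cs.IsReduced α) :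
    cs.IsReduced β := by
  rw [CoxeterSystem.IsReduced, ← h.wordProd_eq cs, ← h.length_eq]
  exact hα

/-! ### A criterion for median graphs -/

/-! The braid class sits isometrically in a cube, as a set of vertices closed under majority. Call
`i` a center if some word of the class admits a braid move on positions `i`, `i+1`, `i+2`. Centers
are never consecutive (`not_isCenter_succ`), so a move at `i` alters the middle letter of no other
center. Each middle letter takes at most two values over the class, and together they determine the
word (`two_letters`, `eq_of_center_eq`). A word is thus encoded by the set of centers at which it
differs from a base word, and a move toggles one element of this set.

Overlapping centers `i` and `i+2` interact in one way only: by triangle-freeness a letter `p`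
travels through `pxy`, `xpy`, `xyp` (`exists_triple`), so one of the four pairs of middle letters is
forbidden. Constraints on pairs survive majority votes. In terms of moves (`isBraidAt_of_between`):
when `w` crosses an edge, the majority of `u`, `v`, `w` stays or crosses an edge. This makes graph
distance equal to Hamming distance and the majority the unique median (`isMedian_of_majority`). -/

namespace Finset

variable {ι : Type*} [DecidableEq ι]

/-- The elements that belong to at least two of three finite sets. -/
def majority (a b c : Finset ι) : Finset ι :=
  (a ∩ b) ∪ (a ∩ c) ∪ (b ∩ c)

theorem mem_majority {a b c : Finset ι} {i : ι} :
    i ∈ majority a b c ↔ (i ∈ a ∧ i ∈ b) ∨ (i ∈ a ∧ i ∈ c) ∨ (i ∈ b ∧ i ∈ c) := by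
  simp only [majority, mem_union, mem_inter, or_assoc]

theorem eq_majority {a b c d : Finset ι} (h₁ : a ∩ b ⊆ d) (h₂ : d ⊆ a ∪ b) (h₃ : a ∩ c ⊆ d)
    (h₄ : d ⊆ a ∪ c) (h₅ : b ∩ c ⊆ d) (h₆ : d ⊆ b ∪ c) : d = majority a b c := by
  refine Subset.antisymm (fun i hi => ?_) (union_subset (union_subset h₁ h₃) h₅)
  have h₂ := mem_union.1 (h₂ hi)
  have h₄ := mem_union.1 (h₄ hi)
  have h₆ := mem_union.1 (h₆ hi)
  rw [mem_majority]
  tauto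

theorem card_symmDiff_triangle (a b c : Finset ι) :
    (symmDiff a b).card ≤ (symmDiff a c).card + (symmDiff c b).card :=
  (card_le_card (symmDiff_triangle a c b)).trans (card_union_le _ _)

theorem card_symmDiff_eq_add_iff {a b c : Finset ι} :
    (symmDiff a b).card = (symmDiff a c).card + (symmDiff c b).card ↔
      a ∩ b ⊆ c ∧ c ⊆ a ∪ b := by
  constructor
  · intro h
    have h1 := card_le_card (symmDiff_triangle a c b)
    rw [sup_eq_union] at h1
    have h2 := card_union_add_card_inter (symmDiff a c) (symmDiff c b)
    have h3 : symmDiff a c ∩ symmDiff c b = ∅ := card_eq_zero.1 (by omega)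
    have h4 : ∀ i, i ∉ symmDiff a c ∩ symmDiff c b := by simp [h3]
    simp only [mem_inter, mem_symmDiff] at h4
    constructor <;> intro i hi <;> have := h4 i <;> simp only [mem_inter, mem_union] at * <;> tauto
  · rintro ⟨h1, h2⟩
    rw [← card_union_of_disjoint]
    · congr 1
      ext i
      have h1 := @h1 i
      have h2 := @h2 i
      simp only [mem_inter, mem_union, mem_symmDiff] at *
      tauto
    · rw [disjoint_left]
      intro i
      have h1 := @h1 i
      have h2 := @h2 i
      simp only [mem_inter, mem_union, mem_symmDiff] at *
      tauto

end Finset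

namespace SimpleGraph

variable {V : Type*} {G : SimpleGraph V}

theorem Connected.induction_adj (hG : G.Connected) {P : V → Prop} {u : V} (hu : P u)
    (hs : ∀ v w, G.Adj v w → P v → P w) (v : V) : P v := by
  obtain ⟨p⟩ := hG.preconnected u v
  induction p with
  | nil => exact hu
  | cons h _ ih => exact ih (hs _ _ h hu)

section Majority

variable {ι : Type*} [DecidableEq ι] {σ : V → Finset ι}

theorem card_symmDiff_le_length (hadj : ∀ u v, G.Adj u v → (symmDiff (σ u) (σ v)).card = 1)
    {u v : V} (p : G.Walk u v) : (symmDiff (σ u) (σ v)).card ≤ p.length := by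
  induction p with
  | nil => simp
  | @cons u v w h p ih =>
    have h1 := Finset.card_symmDiff_triangle (σ u) (σ w) (σ v)
    rw [hadj _ _ h] at h1
    rw [Walk.length_cons]
    omega

variable (hG : G.Connected) (hσ : Function.Injective σ)
  (hadj : ∀ u v, G.Adj u v → (symmDiff (σ u) (σ v)).card = 1)
  (hmaj : ∀ u v w w' m, G.Adj w w' → σ m = Finset.majority (σ u) (σ v) (σ w) →
    ∃ m', (m' = m ∨ G.Adj m m') ∧ σ m' = Finset.majority (σ u) (σ v) (σ w'))

include hG hσ hadj hmaj

/-- If no neighbour of `u` is closer to `v`, the majority of `u`, `v`, `w` cannot leave `u` as `w`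
walks from `u` to `v`; but at `w = v` it is `v`. -/
theorem exists_adj_card_symmDiff_lt {u v : V} (huv : u ≠ v) :
    ∃ u', G.Adj u u' ∧ (symmDiff (σ u') (σ v)).card < (symmDiff (σ u) (σ v)).card := by
  by_contra! hcon
  have key : ∀ w, σ u = Finset.majority (σ u) (σ v) (σ w) := by
    refine hG.induction_adj (u := u) ?_ ?_
    · ext i
      rw [Finset.mem_majority]
      tauto
    · intro w w' hw h
      obtain ⟨m', hm | hm, hm'⟩ := hmaj u v w w' u hw h
      · rw [← hm', hm]
      -- As a majority involving `u` and `v`, the neighbour `m'` lies between them, hence is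
      -- strictly closer to `v`.
      · have h1 : (symmDiff (σ u) (σ v)).card =
            (symmDiff (σ u) (σ m')).card + (symmDiff (σ m') (σ v)).card := by
          rw [Finset.card_symmDiff_eq_add_iff, hm']
          constructor <;> intro i <;>
            simp only [Finset.mem_majority, Finset.mem_inter, Finset.mem_union] <;> tauto
        have h2 := hcon m' hm
        have h3 := hadj _ _ hm
        omega
  apply huv
  apply hσ
  rw [key v]
  ext i
  rw [Finset.mem_majority]
  tauto

theorem dist_eq_card_symmDiff (u v : V) : G.dist u v = (symmDiff (σ u) (σ v)).card := by
  apply le_antisymm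
  · induction hn : (symmDiff (σ u) (σ v)).card using Nat.strong_induction_on generalizing u with
    | _ n ih =>
      by_cases huv : u = v
      · simp [huv]
      · obtain ⟨u', hu, hlt⟩ := exists_adj_card_symmDiff_lt hG hσ hadj hmaj huv
        have h1 := ih _ (hn ▸ hlt) u' rfl
        have h2 := hG.dist_triangle (u := u) (v := u') (w := v)
        rw [dist_eq_one_iff_adj.2 hu] at h2
        omega
  · obtain ⟨p, hp⟩ := hG.exists_walk_length_eq_dist u v
    rw [← hp]
    exact card_symmDiff_le_length hadj p

theorem isMedian_of_majority : G.IsMedian := by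
  refine ⟨hG, fun u v w => ?_⟩
  have hmem : ∀ x y z, z ∈ G.geodesicInterval x y ↔ σ x ∩ σ y ⊆ σ z ∧ σ z ⊆ σ x ∪ σ y := by
    intro x y z
    rw [geodesicInterval, Set.mem_ofPred_eq]
    simp only [dist_eq_card_symmDiff hG hσ hadj hmaj]
    exact Finset.card_symmDiff_eq_add_iff
  obtain ⟨m, hm⟩ : ∃ m, σ m = Finset.majority (σ u) (σ v) (σ w) := by
    refine hG.induction_adj (P := fun w => ∃ m, σ m = Finset.majority (σ u) (σ v) (σ w))
      (u := u) ⟨u, ?_⟩ ?_ w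
    · ext i
      rw [Finset.mem_majority]
      tauto
    · rintro w w' hw ⟨m, hm⟩
      obtain ⟨m', -, h⟩ := hmaj u v w w' m hw hm
      exact ⟨m', h⟩
  rw [Set.ncard_eq_one]
  refine ⟨m, Set.ext fun z => ?_⟩
  simp only [Set.mem_inter_iff, hmem, Set.mem_singleton_iff]
  constructor
  · rintro ⟨⟨⟨h1, h2⟩, h3, h4⟩, h5, h6⟩
    exact hσ (hm ▸ Finset.eq_majority h1 h2 h3 h4 h5 h6)
  · rintro rfl
    rw [hm]
    refine ⟨⟨⟨?_, ?_⟩, ?_, ?_⟩, ?_, ?_⟩ <;> intro i <;>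
      simp only [Finset.mem_majority, Finset.mem_inter, Finset.mem_union] <;> tauto

end Majority

end SimpleGraph

/-! ### Braid moves on sequences of letters -/

namespace BraidSeq

variable {L V : Type*}

/-- The factor of `f` that starts in position `i` is of the form `sts` with `s`, `t` related. -/
def IsBraidAt (A : L → L → Prop) (f : ℕ → L) (i : ℕ) : Prop :=
  A (f i) (f (i + 1)) ∧ f (i + 2) = f i

/-- Replace the factor `sts` in position `i` by `tst`. -/
def flip (f : ℕ → L) (i : ℕ) : ℕ → L := fun k =>
  if k = i then f (i + 1) else if k = i + 1 then f i else if k = i + 2 then f (i + 1) else f k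

@[simp] theorem flip_zero (f : ℕ → L) (i : ℕ) : flip f i i = f (i + 1) := by simp [flip]

@[simp] theorem flip_one (f : ℕ → L) (i : ℕ) : flip f i (i + 1) = f i := by simp [flip]

@[simp] theorem flip_two (f : ℕ → L) (i : ℕ) : flip f i (i + 2) = f (i + 1) := by simp [flip]

theorem flip_of_ne (f : ℕ → L) {i k : ℕ} (h : k ≠ i) (h₁ : k ≠ i + 1) (h₂ : k ≠ i + 2) :
    flip f i k = f k := by
  simp [flip, h, h₁, h₂]

theorem IsBraidAt.congr {A : L → L → Prop} {f g : ℕ → L} {i : ℕ} (h : IsBraidAt A f i)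
    (h₀ : g i = f i) (h₁ : g (i + 1) = f (i + 1)) (h₂ : g (i + 2) = f (i + 2)) :
    IsBraidAt A g i := by
  rwa [IsBraidAt, h₀, h₁, h₂]

/-- A connected graph whose vertices are sequences of letters, with edges the braid moves: an
abstract form of a braid class of reduced expressions. -/
structure BraidSystem (A : L → L → Prop) (G : SimpleGraph V) (φ : V → ℕ → L) : Prop where
  symm : ∀ s t, A s t → A t s
  irrefl : ∀ s, ¬ A s s
  triangleFree : ∀ s t u, A s t → A t u → ¬ A s u
  connected : G.Connected
  injective : Function.Injective φ
  adj_iff : ∀ u v, G.Adj u v ↔ ∃ i, IsBraidAt A (φ u) i ∧ φ v = flip (φ u) i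
  exists_flip : ∀ u i, IsBraidAt A (φ u) i → ∃ v, φ v = flip (φ u) i
  reduced : ∀ u i, IsBraidAt A (φ u) i → ¬ IsBraidAt A (φ u) (i + 1)
  bounded : ∃ n, ∀ u i, IsBraidAt A (φ u) i → i < n

variable {A : L → L → Prop} {G : SimpleGraph V} {φ : V → ℕ → L}

/-- Some vertex admits a braid move in position `i`. -/
def IsCenter (A : L → L → Prop) (φ : V → ℕ → L) (i : ℕ) : Prop :=
  ∃ u, IsBraidAt A (φ u) i

namespace BraidSystem

variable (S : BraidSystem A G φ)
include S

/-! ### Centers are never consecutive -/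

theorem isBraidAt_flip {f : ℕ → L} {i : ℕ} (h : IsBraidAt A f i) : IsBraidAt A (flip f i) i := by
  simpa [IsBraidAt] using S.symm _ _ h.1

/-- In a counterexample at minimal distance, the moves along a geodesic split into moves left and
right of the overlap. Performing only the right ones on `u` yields a word with braids at both `i`
and `i + 1`, which is not reduced. -/
theorem not_isBraidAt_succ_of_dist (n : ℕ) : ∀ u v, G.dist u v = n → ∀ i, IsBraidAt A (φ u) i →
    ¬ IsBraidAt A (φ v) (i + 1) := by
  induction n using Nat.strong_induction_on with
  | _ n ih =>
    intro u v huv i hu hv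
    obtain ⟨p, hp⟩ := S.connected.exists_walk_length_eq_dist u v
    have hpn : p.length = n := hp.trans huv
    have hle : ∀ a ≤ n, G.dist u (p.getVert a) ≤ a ∧ G.dist (p.getVert a) v ≤ n - a := by
      intro a ha
      have h1 := SimpleGraph.dist_le (p.take a)
      have h2 := SimpleGraph.dist_le (p.drop a)
      rw [SimpleGraph.Walk.take_length] at h1
      rw [SimpleGraph.Walk.drop_length] at h2
      exact ⟨h1.trans (min_le_left _ _), h2.trans (by omega)⟩
    -- `h` is the hybrid word: the left part of `u` followed by the right part of the current
    -- vertex.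
    have key : ∀ a ≤ n, ∃ h, (∀ k ≤ i, φ h k = φ u k) ∧
        (∀ k > i, φ h k = φ (p.getVert a) k) ∧ φ (p.getVert a) (i + 1) = φ u (i + 1) ∧
        φ (p.getVert a) (i + 2) = φ u (i + 2) := by
      intro a
      induction a with
      | zero => exact fun _ => ⟨u, by simp⟩
      | succ a iha =>
        intro ha
        obtain ⟨h, hl, hr, h1, h2⟩ := iha (by omega)
        obtain ⟨k, hk, hk'⟩ := (S.adj_iff _ _).1 (p.adj_getVert_succ (i := a) (by omega))
        have hk2 : IsBraidAt A (φ (p.getVert (a + 1))) k := hk' ▸ S.isBraidAt_flip hk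
        obtain ⟨d1, d2⟩ := hle a (by omega)
        obtain ⟨d3, d4⟩ := hle (a + 1) ha
        -- A move at `i - 1`, `i`, `i + 1` or `i + 2` would form a closer counterexample with `u` or
        -- `v`. So either `k + 2 ≤ i` or `k ≥ i + 3`.
        have c1 : k ≠ i + 1 := fun h => ih _ (by omega) _ _ rfl i hu (h ▸ hk)
        have c2 : k + 1 ≠ i := fun h => ih (G.dist (p.getVert a) u)
          (by rw [SimpleGraph.dist_comm]; omega) _ _ rfl k hk (h ▸ hu)
        have c3 : k ≠ i := fun h => ih (G.dist (p.getVert (a + 1)) v)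
          (by omega) _ _ rfl k hk2 (h ▸ hv)
        have c4 : k ≠ i + 2 := fun h => ih (G.dist v (p.getVert (a + 1)))
          (by rw [SimpleGraph.dist_comm]; omega) _ _ rfl (i + 1) hv (h ▸ hk2)
        have e1 : φ (p.getVert (a + 1)) (i + 1) = φ (p.getVert a) (i + 1) := by
          rw [hk', flip_of_ne] <;> omega
        have e2 : φ (p.getVert (a + 1)) (i + 2) = φ (p.getVert a) (i + 2) := by
          rw [hk', flip_of_ne] <;> omega
        rcases lt_or_ge k i with hki | hki
        · refine ⟨h, hl, fun j hj => ?_, e1.trans h1, e2.trans h2⟩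
          rw [hr j hj, hk', flip_of_ne] <;> omega
        · have hb : IsBraidAt A (φ h) k :=
            hk.congr (hr _ (by omega)) (hr _ (by omega)) (hr _ (by omega))
          obtain ⟨h', hh'⟩ := S.exists_flip h k hb
          refine ⟨h', fun j hj => ?_, fun j hj => ?_, e1.trans h1, e2.trans h2⟩
          · rw [hh', flip_of_ne, hl j hj] <;> omega
          · rw [hh', hk']
            simp only [flip]
            rw [hr k (by omega), hr (k + 1) (by omega), hr j hj]
    obtain ⟨h, hl, hr, h1, h2⟩ := key n le_rfl
    have hend : p.getVert n = v := by rw [← hpn, SimpleGraph.Walk.getVert_length]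
    rw [hend] at hr h1 h2
    refine S.reduced h i ?_ ?_
    · exact hu.congr (hl _ le_rfl) ((hr _ (by omega)).trans h1) ((hr _ (by omega)).trans h2)
    · exact hv.congr (hr _ (by omega)) (hr _ (by omega)) (hr _ (by omega))

theorem not_isCenter_succ {i : ℕ} : IsCenter A φ i → ¬ IsCenter A φ (i + 1) :=
  fun ⟨u, hu⟩ ⟨v, hv⟩ => S.not_isBraidAt_succ_of_dist _ u v rfl i hu hv

theorem ne_succ {i k : ℕ} (hi : IsCenter A φ i) (hk : IsCenter A φ k) : k ≠ i + 1 := by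
  rintro rfl
  exact S.not_isCenter_succ hi hk

theorem forall_of_flip {Q : (ℕ → L) → Prop} {u : V} (hu : Q (φ u))
    (hs : ∀ f k, IsCenter A φ k → IsBraidAt A f k → Q f → Q (flip f k)) (v : V) : Q (φ v) := by
  refine S.connected.induction_adj (P := fun v => Q (φ v)) hu ?_ v
  intro v w hvw hv
  obtain ⟨i, hi, hw⟩ := (S.adj_iff _ _).1 hvw
  rw [hw]
  exact hs _ _ ⟨v, hi⟩ hi hv

/-! ### Letters that occur around a center -/

theorem apply_eq_of_not_isCenter {k : ℕ} (h₀ : ¬ IsCenter A φ k)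
    (h₁ : ∀ i, i + 1 = k → ¬ IsCenter A φ i) (h₂ : ∀ i, i + 2 = k → ¬ IsCenter A φ i)
    (u v : V) : φ v k = φ u k := by
  refine S.forall_of_flip (Q := fun f => f k = φ u k) rfl (fun f i hi _ hf => ?_) v
  rw [flip_of_ne, hf]
  · rintro rfl
    exact h₀ hi
  · exact fun h => h₁ i h.symm hi
  · exact fun h => h₂ i h.symm hi

theorem left_pair {i : ℕ} (hi : IsCenter A φ i) (hl : ∀ k, k + 2 = i → ¬ IsCenter A φ k) :
    ∃ s t, s ≠ t ∧
      ∀ u, (φ u i = s ∧ φ u (i + 1) = t) ∨ (φ u i = t ∧ φ u (i + 1) = s) := by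
  obtain ⟨u, hu⟩ := hi
  refine ⟨φ u i, φ u (i + 1), fun h => S.irrefl _ (h ▸ hu.1), ?_⟩
  refine S.forall_of_flip (Q := fun f => (f i = φ u i ∧ f (i + 1) = φ u (i + 1)) ∨
    (f i = φ u (i + 1) ∧ f (i + 1) = φ u i)) (Or.inl ⟨rfl, rfl⟩) (fun f k hk _ hf => ?_)
  by_cases hki : k = i
  · subst hki
    rw [flip_zero, flip_one]
    tauto
  · have h1 := S.ne_succ hk ⟨u, hu⟩
    have h2 := S.ne_succ ⟨u, hu⟩ hk
    have h3 : k + 2 ≠ i := fun h => hl k h hk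
    rw [flip_of_ne f (by omega) (by omega) (by omega),
      flip_of_ne f (by omega) (by omega) (by omega)]
    exact hf

theorem right_pair {i : ℕ} (hi : IsCenter A φ i) (hr : ¬ IsCenter A φ (i + 2)) :
    ∃ s t, s ≠ t ∧
      ∀ u, (φ u (i + 2) = s ∧ φ u (i + 1) = t) ∨ (φ u (i + 2) = t ∧ φ u (i + 1) = s) := by
  obtain ⟨u, hu⟩ := hi
  refine ⟨φ u i, φ u (i + 1), fun h => S.irrefl _ (h ▸ hu.1), ?_⟩
  refine S.forall_of_flip (Q := fun f => (f (i + 2) = φ u i ∧ f (i + 1) = φ u (i + 1)) ∨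
    (f (i + 2) = φ u (i + 1) ∧ f (i + 1) = φ u i)) (Or.inl ⟨hu.2, rfl⟩) (fun f k hk hb hf => ?_)
  by_cases hki : k = i
  · subst hki
    rw [flip_two, flip_one, ← hb.2]
    tauto
  · have h1 := S.ne_succ hk ⟨u, hu⟩
    have h2 := S.ne_succ ⟨u, hu⟩ hk
    have h3 : k ≠ i + 2 := fun h => hr (h ▸ hk)
    rw [flip_of_ne f (by omega) (by omega) (by omega),
      flip_of_ne f (by omega) (by omega) (by omega)]
    exact hf

/-- The three local states at two neighbouring centers. -/
def _root_.BraidSeq.IsTriple (x p y : L) (f : ℕ → L) (i : ℕ) : Prop :=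
  (f (i + 1) = p ∧ f (i + 2) = x ∧ f (i + 3) = y) ∨
  (f (i + 1) = x ∧ f (i + 2) = p ∧ f (i + 3) = y) ∨
  (f (i + 1) = x ∧ f (i + 2) = y ∧ f (i + 3) = p)

theorem forall_isTriple {i : ℕ} (hi : IsCenter A φ i) (hi2 : IsCenter A φ (i + 2)) {x p y : L}
    (hxp : A x p) (hpy : A p y) {u : V} (hu : IsTriple x p y (φ u) i) (v : V) :
    IsTriple x p y (φ v) i := by
  have hxy : ¬ A x y := S.triangleFree _ _ _ hxp hpy
  refine S.forall_of_flip (Q := fun f => IsTriple x p y f i) hu (fun f k hk hb hf => ?_) v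
  have hpx := S.symm _ _ hxp
  have hyp := S.symm _ _ hpy
  have hyx : ¬ A y x := fun h => hxy (S.symm _ _ h)
  unfold IsTriple at hf ⊢
  by_cases hki : k = i
  · subst hki
    have h1 : A (f (k + 1)) (f (k + 2)) := hb.2 ▸ S.symm _ _ hb.1
    rw [flip_one, flip_two, flip_of_ne f (by omega) (by omega) (by omega), ← hb.2]
    rcases hf with ⟨a, b, c⟩ | ⟨a, b, c⟩ | ⟨a, b, c⟩
    · exact Or.inr (Or.inl ⟨b, a, c⟩)
    · exact Or.inl ⟨b, a, c⟩
    -- In state `xyp` a move at `i` would need `x` and `y` adjacent.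
    · exact absurd (a ▸ b ▸ h1) hxy
  by_cases hki2 : k = i + 2
  · subst hki2
    have h1 : A (f (i + 2)) (f (i + 3)) := hb.1
    rw [flip_of_ne f (by omega) (by omega) (by omega), flip_zero, flip_one]
    rcases hf with ⟨a, b, c⟩ | ⟨a, b, c⟩ | ⟨a, b, c⟩
    · exact absurd (b ▸ c ▸ h1) hxy
    · exact Or.inr (Or.inr ⟨a, c, b⟩)
    · exact Or.inr (Or.inl ⟨a, c, b⟩)
  have h1 := S.ne_succ hk hi
  have h2 := S.ne_succ hi hk
  have h3 := S.ne_succ hi2 hk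
  rw [flip_of_ne f (by omega) (by omega) (by omega), flip_of_ne f (by omega) (by omega) (by omega),
    flip_of_ne f (by omega) (by omega) (by omega)]
  exact hf

/-- In a word with a braid at `i + 2`, the letter in position `i + 1` is adjacent to one of the next
two letters, since otherwise no move at `i` could ever arise. That neighbour is `p`. Equality `x =
y` would create a braid at `i + 1`. -/
theorem exists_triple {i : ℕ} (hi : IsCenter A φ i) (hi2 : IsCenter A φ (i + 2)) :
    ∃ x p y, x ≠ p ∧ p ≠ y ∧ x ≠ y ∧ ¬ A x y ∧ ∀ u, IsTriple x p y (φ u) i := by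
  have hnc : ¬ IsCenter A φ (i + 1) := S.not_isCenter_succ hi
  obtain ⟨u, hu⟩ := id hi2
  have hpy : A (φ u (i + 2)) (φ u (i + 3)) := hu.1
  have hpy' : φ u (i + 2) ≠ φ u (i + 3) := fun h => S.irrefl _ (h ▸ hpy)
  obtain ⟨v, hv⟩ := S.exists_flip u (i + 2) hu
  by_cases hxp : A (φ u (i + 1)) (φ u (i + 2))
  · refine ⟨φ u (i + 1), φ u (i + 2), φ u (i + 3), fun h => S.irrefl _ (h ▸ hxp), hpy',
      fun h => hnc ⟨u, hxp, h.symm⟩,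
      S.triangleFree _ _ _ hxp hpy, S.forall_isTriple hi hi2 hxp hpy (u := u) ?_⟩
    exact Or.inr (Or.inl ⟨rfl, rfl, rfl⟩)
  by_cases hxy : A (φ u (i + 1)) (φ u (i + 3))
  · have v1 : φ v (i + 1) = φ u (i + 1) := by
      rw [hv, flip_of_ne] <;> omega
    have v2 : φ v (i + 2) = φ u (i + 3) := by rw [hv, flip_zero]
    have v3 : φ v (i + 3) = φ u (i + 2) := by rw [hv]; exact flip_one _ _
    refine ⟨φ u (i + 1), φ u (i + 3), φ u (i + 2), fun h => S.irrefl _ (h ▸ hxy), hpy'.symm,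
      fun h => hnc ⟨v, ?_, ?_⟩, S.triangleFree _ _ _ hxy (S.symm _ _ hpy),
      S.forall_isTriple hi hi2 hxy (S.symm _ _ hpy) (u := v) ?_⟩
    · rwa [v1, v2]
    · exact v3.trans (h.symm.trans v1.symm)
    · exact Or.inr (Or.inl ⟨v1, v2, v3⟩)
  -- With neither adjacency, position `i + 1` stays fixed and the next two letters can only swap, so
  -- the braid of `w` at `i` is impossible.
  exfalso
  obtain ⟨w, hw⟩ := id hi
  have key := S.forall_of_flip (Q := fun f => f (i + 1) = φ u (i + 1) ∧
    ((f (i + 2) = φ u (i + 2) ∧ f (i + 3) = φ u (i + 3)) ∨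
      (f (i + 2) = φ u (i + 3) ∧ f (i + 3) = φ u (i + 2)))) (u := u)
    ⟨rfl, Or.inl ⟨rfl, rfl⟩⟩ ?_ w
  · have hA : A (φ w (i + 1)) (φ w (i + 2)) := hw.2 ▸ S.symm _ _ hw.1
    obtain ⟨a, ⟨b, -⟩ | ⟨b, -⟩⟩ := key <;> rw [a, b] at hA
    exacts [hxp hA, hxy hA]
  rintro f k hk hb ⟨a, h⟩
  by_cases hki : k = i
  · subst hki
    have hA : A (f (k + 1)) (f (k + 2)) := hb.2 ▸ S.symm _ _ hb.1
    obtain ⟨b, -⟩ | ⟨b, -⟩ := h <;> rw [a, b] at hA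
    exacts [(hxp hA).elim, (hxy hA).elim]
  by_cases hki2 : k = i + 2
  · subst hki2
    rw [flip_of_ne f (by omega) (by omega) (by omega), flip_zero, flip_one]
    exact ⟨a, h.symm.imp And.symm And.symm⟩
  have h1 := S.ne_succ hk hi
  have h2 := S.ne_succ hi hk
  have h3 := S.ne_succ hi2 hk
  rw [flip_of_ne f (by omega) (by omega) (by omega), flip_of_ne f (by omega) (by omega) (by omega),
    flip_of_ne f (by omega) (by omega) (by omega)]
  exact ⟨a, h⟩

end BraidSystem

end BraidSeq

/-! ### Encoding by middle letters, and closure under majority -/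

namespace BraidSeq

variable {L V : Type*} {A : L → L → Prop} {G : SimpleGraph V} {φ : V → ℕ → L}

open Classical in
/-- The set of centers at which a vertex differs from a base vertex. -/
noncomputable def signature (A : L → L → Prop) (φ : V → ℕ → L) (n : ℕ) (u₀ u : V) : Finset ℕ :=
  (Finset.range n).filter fun i => IsCenter A φ i ∧ φ u (i + 1) ≠ φ u₀ (i + 1)

namespace BraidSystem

variable (S : BraidSystem A G φ)
include S

theorem two_letters {i : ℕ} (hi : IsCenter A φ i) :
    ∃ s t, ∀ u, φ u (i + 1) = s ∨ φ u (i + 1) = t := by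
  by_cases hl : IsCenter A φ (i + 2)
  · obtain ⟨x, p, y, -, -, -, -, h⟩ := S.exists_triple hi hl
    refine ⟨p, x, fun u => ?_⟩
    rcases h u with ⟨a, -⟩ | ⟨a, -⟩ | ⟨a, -⟩ <;> simp [a]
  · obtain ⟨s, t, -, h⟩ := S.right_pair hi hl
    exact ⟨t, s, fun u => (h u).imp And.right And.right⟩

theorem eq_of_center_eq {u v : V}
    (h : ∀ i, IsCenter A φ i → φ u (i + 1) = φ v (i + 1)) : u = v := by
  apply S.injective
  funext k
  by_cases hc : ∃ i, i + 1 = k ∧ IsCenter A φ i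
  · obtain ⟨i, rfl, hi⟩ := hc
    exact h i hi
  have h1 : ∀ i, i + 1 = k → ¬ IsCenter A φ i := fun i hi h => hc ⟨i, hi, h⟩
  by_cases hl : ∃ i, i + 2 = k ∧ IsCenter A φ i
  · obtain ⟨i, rfl, hi⟩ := hl
    have e1 := h i hi
    by_cases hr : IsCenter A φ (i + 2)
    · obtain ⟨x, p, y, hxp, hpy, hxy, -, hT⟩ := S.exists_triple hi hr
      have e2 : φ u (i + 3) = φ v (i + 3) := h _ hr
      have hu := hT u
      have hv := hT v
      unfold IsTriple at hu hv
      grind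
    · obtain ⟨s, t, hst, hT⟩ := S.right_pair hi hr
      have hu := hT u
      have hv := hT v
      grind
  · have h2 : ∀ i, i + 2 = k → ¬ IsCenter A φ i := fun i hi h => hl ⟨i, hi, h⟩
    by_cases hr : IsCenter A φ k
    · obtain ⟨s, t, hst, hT⟩ := S.left_pair hr h2
      have e1 := h k hr
      have hu := hT u
      have hv := hT v
      grind
    · exact S.apply_eq_of_not_isCenter hr h1 h2 v u

/-- Here `m` plays the majority of `u`, `v`, `w`. The braid of `w` excludes one state of each
neighbouring triple. As `u` and `v` differ at `i`, one of them has `p` as its middle letter there,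
which forces its middle letter at the neighbouring center to be that of `w`. Hence `m` agrees with
`w` there too. -/
theorem isBraidAt_of_between {u v w m : V} {i : ℕ} (hw : IsBraidAt A (φ w) i)
    (huv : φ u (i + 1) ≠ φ v (i + 1))
    (heq : ∀ k, IsCenter A φ k → φ u (k + 1) = φ v (k + 1) → φ m (k + 1) = φ u (k + 1))
    (hne : ∀ k, IsCenter A φ k → φ u (k + 1) ≠ φ v (k + 1) → φ m (k + 1) = φ w (k + 1)) :
    IsBraidAt A (φ m) i := by
  have hi : IsCenter A φ i := ⟨w, hw⟩
  have hm := hne i hi huv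
  refine hw.congr ?_ hm ?_
  · by_cases hl : ∃ k, k + 2 = i ∧ IsCenter A φ k
    · obtain ⟨k, rfl, hk⟩ := hl
      obtain ⟨x, p, y, hxp, hpy, hxy, hA, hT⟩ := S.exists_triple hk hi
      have e1 := heq k hk
      have e2 := hne k hk
      have hb : A (φ w (k + 2)) (φ w (k + 3)) := hw.1
      change φ m (k + 3) = φ w (k + 3) at hm
      change φ u (k + 3) ≠ φ v (k + 3) at huv
      have t1 := hT u
      have t2 := hT v
      have t3 := hT w
      have t4 := hT m
      unfold IsTriple at t1 t2 t3 t4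
      grind
    · obtain ⟨s, t, hst, hT⟩ := S.left_pair hi fun k hk h => hl ⟨k, hk, h⟩
      have t1 := hT w
      have t2 := hT m
      grind
  · by_cases hr : IsCenter A φ (i + 2)
    · obtain ⟨x, p, y, hxp, hpy, hxy, hA, hT⟩ := S.exists_triple hi hr
      have e1 := heq (i + 2) hr
      have e2 := hne (i + 2) hr
      have hb : A (φ w (i + 1)) (φ w (i + 2)) := hw.2 ▸ S.symm _ _ hw.1
      change φ u (i + 3) = φ v (i + 3) → φ m (i + 3) = φ u (i + 3) at e1
      change φ u (i + 3) ≠ φ v (i + 3) → φ m (i + 3) = φ w (i + 3) at e2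
      have t1 := hT u
      have t2 := hT v
      have t3 := hT w
      have t4 := hT m
      unfold IsTriple at t1 t2 t3 t4
      grind
    · obtain ⟨s, t, hst, hT⟩ := S.right_pair hi hr
      have t1 := hT w
      have t2 := hT m
      grind

theorem isMedian : G.IsMedian := by
  obtain ⟨n, hn⟩ := S.bounded
  obtain ⟨u₀⟩ := S.connected.nonempty
  have hmem : ∀ u i, i ∈ signature A φ n u₀ u ↔ IsCenter A φ i ∧ φ u (i + 1) ≠ φ u₀ (i + 1) := by
    intro u i
    classical
    rw [signature, Finset.mem_filter, Finset.mem_range]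
    exact ⟨And.right, fun h => ⟨h.1.elim fun v => hn v i, h⟩⟩
  -- With only two possible letters, two words that both differ from the base word agree.
  have hiff : ∀ u v i, IsCenter A φ i →
      ((i ∈ signature A φ n u₀ u ↔ i ∈ signature A φ n u₀ v) ↔ φ u (i + 1) = φ v (i + 1)) := by
    intro u v i hi
    obtain ⟨s, t, h⟩ := S.two_letters hi
    rw [hmem, hmem]
    have h1 := h u
    have h2 := h v
    have h3 := h u₀
    grind
  have hflip : ∀ u v i, IsBraidAt A (φ u) i → φ v = flip (φ u) i → ∀ k,
      ((k ∈ signature A φ n u₀ u ↔ k ∈ signature A φ n u₀ v) ↔ k ≠ i) := by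
    intro u v i hi hv k
    by_cases hk : IsCenter A φ k
    · rw [hiff _ _ _ hk, hv]
      by_cases hki : k = i
      · subst hki
        simp only [flip_one, ne_eq, not_true_eq_false, iff_false]
        exact fun h => S.irrefl _ (h ▸ hi.1)
      · have h1 := S.ne_succ ⟨u, hi⟩ hk
        have h2 := S.ne_succ hk ⟨u, hi⟩
        rw [flip_of_ne _ (by omega) (by omega) (by omega)]
        simp [hki]
    · have hki : k ≠ i := fun h => hk (h ▸ ⟨u, hi⟩)
      simp [hmem, hk, hki]
  refine SimpleGraph.isMedian_of_majority (σ := signature A φ n u₀) S.connected ?_ ?_ ?_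
  · intro u v huv
    exact S.eq_of_center_eq fun i hi => (hiff u v i hi).1 (by rw [huv])
  · intro u v huv
    obtain ⟨i, hi, hv⟩ := (S.adj_iff _ _).1 huv
    rw [Finset.card_eq_one]
    refine ⟨i, Finset.ext fun k => ?_⟩
    have := hflip u v i hi hv k
    rw [Finset.mem_symmDiff, Finset.mem_singleton]
    tauto
  · intro u v w w' m hww hm
    obtain ⟨i, hi, hw'⟩ := (S.adj_iff _ _).1 hww
    have hmm := fun k => (Finset.ext_iff.1 hm k).trans Finset.mem_majority
    have hfw := hflip w w' i hi hw'
    have hic : IsCenter A φ i := ⟨w, hi⟩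
    -- If `u` and `v` agree at `i`, they outvote `w` and the majority does not change.
    by_cases huv : φ u (i + 1) = φ v (i + 1)
    · refine ⟨m, Or.inl rfl, Finset.ext fun k => ?_⟩
      rw [hmm, Finset.mem_majority]
      have h1 := hfw k
      have h2 := (hiff u v i hic).2 huv
      clear * - h1 h2
      grind
    · have hb : IsBraidAt A (φ m) i := by
        refine S.isBraidAt_of_between hi huv (fun k hk h => ?_) (fun k hk h => ?_)
        · rw [← hiff _ _ _ hk] at h ⊢
          rw [hmm]
          tauto
        · rw [Ne, ← hiff _ _ _ hk] at h
          rw [← hiff _ _ _ hk, hmm]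
          tauto
      obtain ⟨m', hm'⟩ := S.exists_flip m i hb
      refine ⟨m', Or.inr ((S.adj_iff _ _).2 ⟨i, hb, hm'⟩), Finset.ext fun k => ?_⟩
      have h1 := hfw k
      have h2 := hflip m m' i hb hm' k
      have h3 := hmm k
      rw [Finset.mem_majority]
      rw [← hiff _ _ _ hic] at huv
      clear * - h1 h2 h3 huv
      grind

end BraidSystem

end BraidSeq

/-! ### Braid classes of reduced expressions -/

namespace CoxeterMatrix

variable {B : Type*} (M : CoxeterMatrix B)

/-- Adjacency in the Coxeter graph on optional letters; `none` is isolated. -/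
def OptionAdj (a b : Option B) : Prop :=
  ∃ s t, a = some s ∧ b = some t ∧ 3 ≤ M s t

variable {M}

theorem braidWord_eq_of_eq_three {s t : B} (h : M s t = 3) :
    CoxeterSystem.braidWord M s t = [t, s, t] := by
  simp [CoxeterSystem.braidWord, h, CoxeterSystem.alternatingWord]

theorem IsSimplyLaced.eq_three (hM : M.IsSimplyLaced) {s t : B} (h : 3 ≤ M s t) : M s t = 3 :=
  le_antisymm (hM s t).2 h

theorem isBraidAt_getElem?_iff {α : List B} {i : ℕ} :
    BraidSeq.IsBraidAt M.OptionAdj (fun k => α[k]?) i ↔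
      ∃ s t, 3 ≤ M s t ∧ ∃ l r, l.length = i ∧ α = l ++ [s, t, s] ++ r := by
  constructor
  · rintro ⟨⟨s, t, hs, ht, h3⟩, h2⟩
    refine ⟨s, t, h3, α.take i, α.drop (i + 3), ?_, ?_⟩
    · have := (List.getElem?_eq_some_iff.1 hs).1
      simp only [List.length_take]
      omega
    · have h2 : α[i + 2]? = some s := h2.trans hs
      obtain ⟨l0, e0⟩ := List.getElem?_eq_some_iff.1 hs
      obtain ⟨l1, e1⟩ := List.getElem?_eq_some_iff.1 ht
      obtain ⟨l2, e2⟩ := List.getElem?_eq_some_iff.1 h2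
      conv_lhs => rw [← List.take_append_drop i α, List.drop_eq_getElem_cons l0,
        List.drop_eq_getElem_cons l1, List.drop_eq_getElem_cons l2, e0, e1, e2]
      simp
  · rintro ⟨s, t, h3, l, r, rfl, rfl⟩
    refine ⟨⟨s, t, ?_, ?_, h3⟩, ?_⟩ <;> simp

theorem getElem?_braid_eq_flip (l r : List B) (s t : B) :
    (fun k => (l ++ [t, s, t] ++ r)[k]?) =
      BraidSeq.flip (fun k => (l ++ [s, t, s] ++ r)[k]?) l.length := by
  funext k
  by_cases h0 : k = l.length
  · subst h0; simp [List.getElem?_append]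
  by_cases h1 : k = l.length + 1
  · subst h1; simp [List.getElem?_append]
  by_cases h2 : k = l.length + 2
  · subst h2; simp [List.getElem?_append]
  rw [BraidSeq.flip_of_ne _ h0 h1 h2]
  rcases lt_or_ge k l.length with h | h
  · simp only [List.append_assoc, List.getElem?_append_left h]
  · obtain ⟨j, rfl⟩ : ∃ j, k = l.length + 3 + j := ⟨k - (l.length + 3), by omega⟩
    rw [List.getElem?_append_right (by simp), List.getElem?_append_right (by simp)]
    simp

theorem IsSimplyLaced.braidMove_iff (hM : M.IsSimplyLaced) {α β : List B} :
    M.BraidMove α β ↔ ∃ i, BraidSeq.IsBraidAt M.OptionAdj (fun k => α[k]?) i ∧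
      (fun k => β[k]?) = BraidSeq.flip (fun k => α[k]?) i := by
  constructor
  · rintro ⟨s, t, l, r, h3, hα, hβ⟩
    have h3' : 3 ≤ M t s := M.symmetric s t ▸ h3
    rw [braidWord_eq_of_eq_three (hM.eq_three h3)] at hα
    rw [braidWord_eq_of_eq_three (hM.eq_three h3')] at hβ
    -- `braidWord M s t` ends in `t`; having three letters, it also begins with `t`, so the roles of
    -- `s` and `t` are exchanged.
    refine ⟨l.length, isBraidAt_getElem?_iff.2 ⟨t, s, h3', l, r, rfl, hα⟩, ?_⟩
    rw [hα, hβ]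
    exact getElem?_braid_eq_flip l r t s
  · rintro ⟨i, hi, hβ⟩
    obtain ⟨s, t, h3, l, r, rfl, hα⟩ := isBraidAt_getElem?_iff.1 hi
    have h3' : 3 ≤ M t s := M.symmetric s t ▸ h3
    refine ⟨t, s, l, r, h3', ?_, ?_⟩
    · rwa [braidWord_eq_of_eq_three (hM.eq_three h3')]
    · rw [braidWord_eq_of_eq_three (hM.eq_three h3)]
      rw [hα, ← getElem?_braid_eq_flip] at hβ
      exact List.ext_getElem? fun k => congrFun hβ k

theorem braidGraph_connected (α : List B) : (M.braidGraph α).Connected := by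
  have h : ∀ β γ, M.BraidEquiv β γ → ∀ (hβ : β ∈ M.braidClass α) (hγ : γ ∈ M.braidClass α),
      (M.braidGraph α).Reachable ⟨β, hβ⟩ ⟨γ, hγ⟩ := by
    intro β γ h
    induction h with
    | rel β γ h => exact fun _ _ => SimpleGraph.Adj.reachable h
    | refl => exact fun _ _ => SimpleGraph.Reachable.rfl
    | symm _ _ _ ih => exact fun hβ hγ => (ih hγ hβ).symm
    | trans β γ δ h₁ _ ih₁ ih₂ =>
      intro hβ hδ
      have hγ : γ ∈ M.braidClass α := Relation.EqvGen.trans _ _ _ hβ h₁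
      exact (ih₁ hβ hγ).trans (ih₂ hγ hδ)
  have : Nonempty (M.braidClass α) := ⟨⟨α, Relation.EqvGen.refl α⟩⟩
  refine ⟨fun β γ => h _ _ ?_ β.2 γ.2⟩
  exact Relation.EqvGen.trans _ _ _ (Relation.EqvGen.symm _ _ β.2) γ.2

/-- Two consecutive braids form a factor `stst`, which is not reduced because `m(s, t) = 3`. -/
theorem not_isBraidAt_succ_of_isReduced {W : Type*} [Group W] (cs : CoxeterSystem M W)
    (hM : M.IsSimplyLaced) {α : List B} (hα : cs.IsReduced α) {i : ℕ}
    (hi : BraidSeq.IsBraidAt M.OptionAdj (fun k => α[k]?) i) :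
    ¬ BraidSeq.IsBraidAt M.OptionAdj (fun k => α[k]?) (i + 1) := by
  rintro ⟨-, h4⟩
  obtain ⟨s, t, h3, l, r, rfl, rfl⟩ := isBraidAt_getElem?_iff.1 hi
  change (l ++ [s, t, s] ++ r)[l.length + 3]? = (l ++ [s, t, s] ++ r)[l.length + 1]? at h4
  cases r with
  | nil => simp at h4
  | cons a r =>
    have ha : a = t := by simpa [List.getElem?_append] using h4
    subst ha
    have h := (hα.drop l.length).take 4
    simp only [List.append_assoc, List.cons_append, List.nil_append, List.drop_left,
      List.take_succ_cons, List.take_zero] at h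
    have h3' := hM.eq_three h3
    refine cs.not_isReduced_alternatingWord s a (m := 4) (by omega) (by omega) ?_
    simpa [CoxeterSystem.alternatingWord] using h

theorem braidGraph_braidSystem {W : Type*} [Group W] (cs : CoxeterSystem M W)
    (hM : M.IsTypeLambda) {α : List B} (hα : cs.IsReduced α) :
    BraidSeq.BraidSystem M.OptionAdj (M.braidGraph α) (fun β k => β.1[k]?) where
  symm := by
    rintro _ _ ⟨s, t, rfl, rfl, h⟩
    exact ⟨t, s, rfl, rfl, M.symmetric s t ▸ h⟩
  irrefl := by
    rintro _ ⟨s, t, rfl, h, h3⟩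
    obtain rfl := Option.some.inj h
    simp at h3
  triangleFree := by
    classical
    rintro _ _ _ ⟨s, t, rfl, rfl, h1⟩ ⟨t', u, ht, rfl, h2⟩ ⟨s', u', hs, hu, h3⟩
    obtain rfl := Option.some.inj ht
    obtain rfl := Option.some.inj hs
    obtain rfl := Option.some.inj hu
    exact hM.2 {s, t, u} (SimpleGraph.is3Clique_triple_iff.2 ⟨Or.inr h1, Or.inr h3, Or.inr h2⟩)
  connected := braidGraph_connected α
  injective := fun β γ h => Subtype.ext (List.ext_getElem? fun k => congrFun h k)
  adj_iff := fun _ _ => hM.1.braidMove_iff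
  exists_flip := by
    intro β i hi
    obtain ⟨s, t, h3, l, r, rfl, hβ⟩ := isBraidAt_getElem?_iff.1 hi
    have hflip := getElem?_braid_eq_flip l r s t
    rw [← hβ] at hflip
    exact ⟨⟨l ++ [t, s, t] ++ r, Relation.EqvGen.trans _ _ _ β.2
      (Relation.EqvGen.rel _ _ (hM.1.braidMove_iff.2 ⟨_, hi, hflip⟩))⟩, hflip⟩
  reduced := fun β _ hi =>
    not_isBraidAt_succ_of_isReduced cs hM.1 (BraidEquiv.isReduced cs β.2 hα) hi
  bounded := by
    refine ⟨α.length, fun β i hi => ?_⟩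
    obtain ⟨⟨s, t, hs, -⟩, -⟩ := hi
    rw [BraidEquiv.length_eq β.2]
    exact (List.getElem?_eq_some_iff.1 hs).1

end CoxeterMatrix

theorem mainTheorem2 {B W : Type*} [Finite B] [Group W] {M : CoxeterMatrix B}
    (cs : CoxeterSystem M W) (hM : M.IsTypeLambda) (α : List B) (hα : cs.IsReduced α) :
    (M.braidGraph α).IsMedian :=
  (CoxeterMatrix.braidGraph_braidSystem cs hM hα).isMedian
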